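/- Let $A\in\mathbb C^{n\times n}$, $B\in\mathbb C^{n\times m}$, $C\in\mathbb C^{p\times n}$, $D\in\mathbb C^{p\times m}$, and let $G(s)=C(sI-A)^{-1}B+D$ be the transfer function of the system $\dot x=Ax+Bu$, $y=Cx+Du$ (which need not be stable). Let $\varpi\in\mathbb R$ and $\epsilon>0$ be such that $\epsilon I+\jmath\varpi I-A$ is invertible, and let $G_{\epsilon\varpi}$ be the extended system with realization $$A_\epsilon=\jmath\varpi I-\epsilon(\epsilon I+\jmath\varpi I-A)^{-1}(\jmath\varpi I-A),\quad B_\epsilon=\epsilon(\epsilon I+\jmath\varpi I-A)^{-1}B,$$ $$C_\epsilon=\epsilon C(\epsilon I+\jmath\varpi I-A)^{-1},\quad D_\epsilon=D+C(\epsilon I+\jmath\varpi I-A)^{-1}B.$$ Suppose that $A_\epsilon$ is Hurwitz (all its eigenvalues have negative real part) and that this realization is balanced: there is a real diagonal matrix $\Sigma=\mathrm{diag}(\sigma_{1},\dots,\sigma_{n})$ with $\sigma_{1}\ge\dots\ge\sigma_{n}$ such that $$A_\epsilon\Sigma+\Sigma A_\epsilon^*+B_\epsilon B_\epsilon^*=0,\qquad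 A_\epsilon^*\Sigma+\Sigma A_\epsilon+C_\epsilon^*C_\epsilon=0 .$$ Let $0\le r\le n$, $Z_r=[\,I_r\ \ 0\,]\in\mathbb C^{r\times n}$ and $F_r=Z_r(\jmath\varpi I-A_\epsilon)Z_r^T$, and suppose that $\epsilon I-F_r$ is invertible, so that the reduced model $G_r$ with realization $$A_r=\jmath\varpi I-\epsilon F_r(\epsilon I-F_r)^{-1},\quad B_r=\epsilon^{-1}(\epsilon I+\jmath\varpi I-A_r)Z_rB_\epsilon,$$ $$C_r=\epsilon^{-1}C_\epsilon Z_r^T(\epsilon I+\jmath\varpi I-A_r),\quad D_r=D_\epsilon-C_r(\epsilon I+\jmath\varpi I-A_r)^{-1}B_r$$ can be formed. Transfer functions are read as rational functions: removable singularities are filled in. Then $\epsilon I+\jmath\varpi I-A_r$ is invertible, so that the extended system $G_{r\epsilon\varpi}$ of $G_r$, obtained from $(A_r,B_r,C_r,D_r)$ by the same formulas as $G_{\epsilon\varpi}$ from $(A,B,C,D)$, is well defined, and the following hold. 1) $G$ and $G_r$ have no pole at $\jmath\varpi$, and $$\sigma_{\max}\bigl(G(\jmath\varpi)-G_r(\jmath\varpi)\bigr)\le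 2\sum_{i=r+1}^n\sigma_{i}.$$ 2) For every $\omega\in\mathbb R$ such that $\jmath\omega$ is not a pole of $G$ or $G_r$, and also for $\omega=\pm\infty$, where $G=D$ and $G_r=D_r$, $$\sigma_{\max}\bigl(G(\jmath\omega)-G_r(\jmath\omega)\bigr)\le 2\sum_{i=r+1}^n\sigma_{i}+\|G-G_{\epsilon\varpi}\|_\infty+\|G_r-G_{r\epsilon\varpi}\|_\infty,$$ where $\|H\|_\infty\in[0,\infty]$ denotes the supremum of $\sigma_{\max}(H(\jmath\omega))$ over $\omega\in\mathbb R$ (it is $\infty$ if $H$ has a pole on the imaginary axis). -/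

import Mathlib

open Filter Topology
open scoped Matrix ENNReal

noncomputable section

/-- A realization `(A, B, C, D)` over `ℂ` of a continuous-time linear time-invariant system
`x' = A x + B u`, `y = C x + D u` with `n` states, `m` inputs and `p` outputs. -/
structure LTISystem (n m p : ℕ) where
  A : Matrix (Fin n) (Fin n) ℂ
  B : Matrix (Fin n) (Fin m) ℂ
  C : Matrix (Fin p) (Fin n) ℂ
  D : Matrix (Fin p) (Fin m) ℂ

/-- The maximum singular value of a complex matrix, that is, its operator norm with respect to the
Euclidean norms. -/
def sigmaMax {p m : ℕ} (M : Matrix (Fin p) (Fin m) ℂ) : ℝ :=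
  ‖(Matrix.toEuclideanLin M).toContinuousLinearMap‖

/-- `[I 0]`, of size `r × n`. -/
def truncMatrix (r n : ℕ) : Matrix (Fin r) (Fin n) ℂ :=
  Matrix.of fun i j => if (i : ℕ) = (j : ℕ) then 1 else 0

namespace LTISystem

variable {n m p : ℕ}

/-- The expression `C (s I - A)⁻¹ B + D`. It is the transfer function at `s` if `s` is not an
eigenvalue of `A`, and has no meaning otherwise. -/
def transfer (S : LTISystem n m p) (s : ℂ) : Matrix (Fin p) (Fin m) ℂ :=
  S.C * (s • (1 : Matrix (Fin n) (Fin n) ℂ) - S.A)⁻¹ * S.B + S.D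

/-- The transfer function `G`, as a rational function, is finite at `jω` with value `M = G(jω)`.
If `jω` is not an eigenvalue of `A`, then this says `M = C (jω I - A)⁻¹ B + D`; if `jω` is an
eigenvalue of `A` but not a pole of `G`, then it fills in the removable singularity. -/
def HasFreqResponse (S : LTISystem n m p) (ω : ℝ) (M : Matrix (Fin p) (Fin m) ℂ) : Prop :=
  Tendsto S.transfer (𝓝[≠] (Complex.I * (ω : ℂ))) (𝓝 M)

/-- The norm `‖G - H‖_∞`, the supremum over the real frequencies `ω` of the maximum singular value
of `G(jω) - H(jω)`. The finitely many poles of `G` and `H` on the imaginary axis are left out; this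
does not change the supremum, which is `∞` if `G - H` has a pole on the imaginary axis. -/
def supNormDiff {n' : ℕ} (S : LTISystem n m p) (T : LTISystem n' m p) : ℝ≥0∞ :=
  ⨆ (ω : ℝ) (M : Matrix (Fin p) (Fin m) ℂ) (N : Matrix (Fin p) (Fin m) ℂ)
    (_ : S.HasFreqResponse ω M) (_ : T.HasFreqResponse ω N), ENNReal.ofReal (sigmaMax (M - N))

/-- Hurwitz stability: every eigenvalue of `A` has negative real part. -/
def IsHurwitz (S : LTISystem n m p) : Prop :=
  ∀ z ∈ spectrum ℂ S.A, z.re < 0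

/-- The matrix `ε I + jϖ I - A`. -/
def shift (S : LTISystem n m p) (ε ϖ : ℝ) : Matrix (Fin n) (Fin n) ℂ :=
  (ε : ℂ) • (1 : Matrix (Fin n) (Fin n) ℂ) + (Complex.I * (ϖ : ℂ)) • 1 - S.A

/-- The SF-type frequency-dependent extended system with parameters `ε` and `ϖ`. It is meaningful
if `ε I + jϖ I - A` is invertible. -/
def extended (S : LTISystem n m p) (ε ϖ : ℝ) : LTISystem n m p where
  A := (Complex.I * (ϖ : ℂ)) • 1 -
    (ε : ℂ) • ((S.shift ε ϖ)⁻¹ * ((Complex.I * (ϖ : ℂ)) • 1 - S.A))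
  B := (ε : ℂ) • ((S.shift ε ϖ)⁻¹ * S.B)
  C := (ε : ℂ) • (S.C * (S.shift ε ϖ)⁻¹)
  D := S.D + S.C * (S.shift ε ϖ)⁻¹ * S.B

/-- The realization is balanced with Gramian `Σ = diag(σ₁, …, σₙ)`: both Lyapunov equations
`A Σ + Σ A* + B B* = 0` and `A* Σ + Σ A + C* C = 0` hold. -/
def IsBalanced (S : LTISystem n m p) (σ : Fin n → ℝ) : Prop :=
  S.A * Matrix.diagonal (fun i => (σ i : ℂ)) + Matrix.diagonal (fun i => (σ i : ℂ)) * S.Aᴴ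
      + S.B * S.Bᴴ = 0 ∧
  S.Aᴴ * Matrix.diagonal (fun i => (σ i : ℂ)) + Matrix.diagonal (fun i => (σ i : ℂ)) * S.A
      + S.Cᴴ * S.C = 0

/-- The `r × r` matrix `Z (jϖ I - A_ε(ϖ)) Zᵀ` with `Z = [I 0]`. -/
def truncShift (S : LTISystem n m p) (ε ϖ : ℝ) (r : ℕ) : Matrix (Fin r) (Fin r) ℂ :=
  truncMatrix r n * ((Complex.I * (ϖ : ℂ)) • 1 - (S.extended ε ϖ).A) * (truncMatrix r n)ᵀ

/-- The matrix `A_r = jϖ I - ε Z (jϖ I - A_ε) Zᵀ (ε I - Z (jϖ I - A_ε) Zᵀ)⁻¹`. -/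
def reducedA (S : LTISystem n m p) (ε ϖ : ℝ) (r : ℕ) : Matrix (Fin r) (Fin r) ℂ :=
  (Complex.I * (ϖ : ℂ)) • 1 -
    (ε : ℂ) • (S.truncShift ε ϖ r * ((ε : ℂ) • 1 - S.truncShift ε ϖ r)⁻¹)

/-- The matrix `B_r = ε⁻¹ (ε I + jϖ I - A_r) Z B_ε`. -/
def reducedB (S : LTISystem n m p) (ε ϖ : ℝ) (r : ℕ) : Matrix (Fin r) (Fin m) ℂ :=
  (ε : ℂ)⁻¹ • (((ε : ℂ) • 1 + (Complex.I * (ϖ : ℂ)) • 1 - S.reducedA ε ϖ r) *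
    (truncMatrix r n * (S.extended ε ϖ).B))

/-- The matrix `C_r = ε⁻¹ C_ε Zᵀ (ε I + jϖ I - A_r)`. -/
def reducedC (S : LTISystem n m p) (ε ϖ : ℝ) (r : ℕ) : Matrix (Fin p) (Fin r) ℂ :=
  (ε : ℂ)⁻¹ • (((S.extended ε ϖ).C * (truncMatrix r n)ᵀ) *
    ((ε : ℂ) • 1 + (Complex.I * (ϖ : ℂ)) • 1 - S.reducedA ε ϖ r))

/-- The reduced model `(A_r, B_r, C_r, D_r)` of order `r`, where
`D_r = D_ε - C_r (ε I + jϖ I - A_r)⁻¹ B_r`. It is meaningful if `ε I - Z (jϖ I - A_ε) Zᵀ` is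
invertible. -/
def reduced (S : LTISystem n m p) (ε ϖ : ℝ) (r : ℕ) : LTISystem r m p where
  A := S.reducedA ε ϖ r
  B := S.reducedB ε ϖ r
  C := S.reducedC ε ϖ r
  D := (S.extended ε ϖ).D - S.reducedC ε ϖ r *
    ((ε : ℂ) • 1 + (Complex.I * (ϖ : ℂ)) • 1 - S.reducedA ε ϖ r)⁻¹ * S.reducedB ε ϖ r

end LTISystem

end

/-! The Möbius map s ↦ z given by z - jϖ = ε(s - jϖ)/(s - jϖ + ε) fixes jϖ, and G_ε(s) = G(z)
(`transfer_extended`), so G and G_ε agree at jϖ. The formulas for the reduced model invert this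
construction: extending G_r gives exactly the truncation of the balanced extended system to its
first r states (`extended_reduced`). Hence 1) is the balanced truncation bound for G_ε at ϖ, and 2)
follows from the bound at ω by the triangle inequality through the two extended systems.

The truncation bound is proved pointwise on the imaginary axis, one state at a time. Let R = (sI -
A)⁻¹, α its last diagonal entry, c the last column of CR, b the last row of RB. Deleting the last
state changes the transfer function by the rank-one matrix α⁻¹cb. For imaginary s the Lyapunov
equations give ‖b‖² = ‖c‖² = 2σ Re α with σ the last Gramian entry, so the change is at most 2|σ||Re
α|/|α| ≤ 2|σ|. Only invertibility of sI minus each truncated A is needed, which fails at finitely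
many s; there, boundedness makes the singularity removable and the bound passes to the limit.
Stability of A_ε enters through σ ≥ 0 (`nonneg_of_lyapunov`) and finiteness of G_ε on the axis. -/

section MatrixLemmas

open scoped Matrix.Norms.L2Operator ComplexOrder

/-! ### Maximum singular value as an operator norm. -/

theorem sigmaMax_eq_norm {p m : ℕ} (M : Matrix (Fin p) (Fin m) ℂ) : sigmaMax M = ‖M‖ := rfl

theorem continuous_sigmaMax {p m : ℕ} :
    Continuous (sigmaMax : Matrix (Fin p) (Fin m) ℂ → ℝ) :=
  continuous_norm (E := Matrix (Fin p) (Fin m) ℂ)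

theorem sigmaMax_zero {p m : ℕ} : sigmaMax (0 : Matrix (Fin p) (Fin m) ℂ) = 0 :=
  norm_zero (E := Matrix (Fin p) (Fin m) ℂ)

theorem sigmaMax_sub_comm {p m : ℕ} (M N : Matrix (Fin p) (Fin m) ℂ) :
    sigmaMax (M - N) = sigmaMax (N - M) :=
  norm_sub_rev M N

theorem sigmaMax_sub_le {p m : ℕ} (L M N : Matrix (Fin p) (Fin m) ℂ) :
    sigmaMax (L - N) ≤ sigmaMax (L - M) + sigmaMax (M - N) :=
  norm_sub_le_norm_sub_add_norm_sub L M N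

theorem exists_norm_entry_le_sigmaMax {p m : ℕ} (i : Fin p) (j : Fin m) :
    ∃ K : ℝ, 0 ≤ K ∧ ∀ M : Matrix (Fin p) (Fin m) ℂ, ‖M i j‖ ≤ K * sigmaMax M := by
  let f := LinearMap.toContinuousLinearMap (Matrix.entryLinearMap ℂ ℂ i j (m := Fin p) (n := Fin m))
  exact ⟨‖f‖, f.opNorm_nonneg, fun M => f.le_opNorm M⟩

theorem Matrix.norm_sq_of_conjTranspose_mul_self_eq {k : Type*} [Fintype k] [DecidableEq k]
    (c : Matrix k (Fin 1) ℂ) {a : ℝ} (h : (cᴴ * c) 0 0 = (a : ℂ)) : ‖c‖ ^ 2 = |a| := by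
  have h1 : cᴴ * c = Matrix.diagonal fun _ => (a : ℂ) := by
    ext i j
    rw [Subsingleton.elim i 0, Subsingleton.elim j 0, h, Matrix.diagonal_apply_eq]
  rw [sq, ← Matrix.l2_opNorm_conjTranspose_mul_self, h1, Matrix.l2_opNorm_diagonal]
  simp

/-- A rank-one product is bounded by the Gram entries of its factors. -/
theorem sigmaMax_mul_col_row_le {p m : ℕ} (c : Matrix (Fin p) (Fin 1) ℂ)
    (b : Matrix (Fin 1) (Fin m) ℂ) {a : ℝ} (hc : (cᴴ * c) 0 0 = (a : ℂ))
    (hb : (b * bᴴ) 0 0 = (a : ℂ)) : sigmaMax (c * b) ≤ |a| := by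
  have h1 := Matrix.norm_sq_of_conjTranspose_mul_self_eq c hc
  have h2 := Matrix.norm_sq_of_conjTranspose_mul_self_eq bᴴ
    (by rwa [Matrix.conjTranspose_conjTranspose])
  rw [Matrix.l2_opNorm_conjTranspose] at h2
  rw [sigmaMax_eq_norm]
  calc ‖c * b‖ ≤ ‖c‖ * ‖b‖ := Matrix.l2_opNorm_mul c b
    -- Both squared norms equal |a|, so this is the arithmetic-geometric mean inequality.
    _ ≤ |a| := by nlinarith [sq_nonneg (‖c‖ - ‖b‖)]

/-! ### Lyapunov equations of stable matrices. -/

/-- Powers of an element of spectral radius less than one tend to zero. -/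
theorem tendsto_pow_of_spectralRadius_lt_one {R : Type*} [NormedRing R] [NormedAlgebra ℂ R]
    [CompleteSpace R] {a : R} (h : spectralRadius ℂ a < 1) :
    Tendsto (fun k : ℕ => a ^ k) atTop (𝓝 0) := by
  obtain ⟨c, hc, hc1⟩ := ENNReal.lt_iff_exists_nnreal_btwn.1 h
  -- Gelfand's formula: eventually ‖a ^ k‖ ^ (1/k) < c < 1.
  have hev := (spectrum.pow_nnnorm_pow_one_div_tendsto_nhds_spectralRadius a).eventually_lt_const hc
  have hc1' : (c : ℝ) < 1 := by exact_mod_cast hc1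
  refine squeeze_zero_norm' ?_ (tendsto_pow_atTop_nhds_zero_of_lt_one c.coe_nonneg hc1')
  filter_upwards [hev, eventually_gt_atTop 0] with k hk hk0
  have h2 : (((‖a ^ k‖₊ : ℝ≥0∞) ^ (1 / k : ℝ)) ^ k) ≤ (c : ℝ≥0∞) ^ k := pow_le_pow_left' hk.le k
  rw [← ENNReal.rpow_natCast, ← ENNReal.rpow_mul, one_div,
    inv_mul_cancel₀ (by exact_mod_cast hk0.ne'), ENNReal.rpow_one] at h2
  exact_mod_cast h2

/-- A diagonal solution of the Lyapunov equation of a stable matrix is nonnegative. -/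
theorem nonneg_of_lyapunov {n m : ℕ} {A : Matrix (Fin n) (Fin n) ℂ} {B : Matrix (Fin n) (Fin m) ℂ}
    (hA : ∀ z ∈ spectrum ℂ A, z.re < 0) {σ : Fin n → ℝ}
    (h : A * Matrix.diagonal (fun i => (σ i : ℂ)) + Matrix.diagonal (fun i => (σ i : ℂ)) * Aᴴ
      + B * Bᴴ = 0) (i : Fin n) : 0 ≤ σ i := by
  have : Nonempty (Fin n) := ⟨i⟩
  set P := Matrix.diagonal (fun i => (σ i : ℂ)) with hP
  have hres : ∀ z : ℂ, 0 ≤ z.re → IsUnit (algebraMap ℂ _ z - A) := fun z hz => by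
    by_contra hcon
    exact absurd (hA z hcon) (not_lt.2 hz)
  have hu : IsUnit (1 - A) := by simpa using hres 1 (by simp)
  have hdet : IsUnit (1 - A).det := (Matrix.isUnit_iff_isUnit_det _).1 hu
  set K := (1 - A)⁻¹ with hK
  have hKl : K * (1 - A) = 1 := Matrix.nonsing_inv_mul _ hdet
  have hKr : (1 - A) * K = 1 := Matrix.mul_nonsing_inv _ hdet
  -- The Cayley transform moves the spectrum from the left half-plane into the unit disc and turns
  -- the Lyapunov equation into the Stein equation P - TPTᴴ = 2(KB)(KB)ᴴ.
  set T := (1 + A) * K with hT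
  have hT' : T = K * (1 + A) := by
    calc T = (K * (1 - A)) * (1 + A) * K := by rw [hKl, one_mul]
      _ = K * (1 + A) * ((1 - A) * K) := by noncomm_ring
      _ = K * (1 + A) := by rw [hKr, mul_one]
  have hspec : ∀ z ∈ spectrum ℂ T, ‖z‖₊ < 1 := by
    intro z hz
    by_contra hcon
    have hz1 : 1 ≤ ‖z‖ := by exact_mod_cast not_lt.1 hcon
    apply hz
    have e1 : algebraMap ℂ (Matrix (Fin n) (Fin n) ℂ) z - T = ((z - 1) • 1 - (z + 1) • A) * K := by
      have : algebraMap ℂ (Matrix (Fin n) (Fin n) ℂ) z = z • ((1 - A) * K) := by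
        rw [hKr, Algebra.algebraMap_eq_smul_one]
      rw [this, hT]
      simp only [sub_mul, add_mul, smul_sub, sub_smul, add_smul, one_mul, one_smul, smul_mul_assoc]
      abel
    rw [spectrum.mem_resolventSet_iff, e1]
    refine IsUnit.mul ?_ ⟨⟨K, 1 - A, hKl, hKr⟩, rfl⟩
    rcases eq_or_ne (z + 1) 0 with h0 | h0
    · rw [h0, zero_smul, sub_zero]
      have : z - 1 ≠ 0 := by
        intro h1
        have : z + 1 = 2 := by linear_combination h1
        rw [this] at h0
        norm_num at h0
      exact (isUnit_one (M := Matrix (Fin n) (Fin n) ℂ)).smul (Units.mk0 _ this)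
    -- Here (z - 1)/(z + 1) has real part (|z|² - 1)/|z + 1|² ≥ 0, so it is not an eigenvalue of A.
    · have e2 : (z - 1) • (1 : Matrix (Fin n) (Fin n) ℂ) - (z + 1) • A
          = (z + 1) • (algebraMap ℂ _ ((z - 1) / (z + 1)) - A) := by
        rw [smul_sub, Algebra.algebraMap_eq_smul_one, smul_smul, mul_div_cancel₀ _ h0]
      rw [e2]
      refine (hres _ ?_).smul (Units.mk0 _ h0)
      rw [Complex.div_re, ← add_div]
      refine div_nonneg ?_ (Complex.normSq_nonneg _)
      have h3 : 1 ≤ ‖z‖ ^ 2 := by nlinarith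
      rw [Complex.sq_norm, Complex.normSq_apply] at h3
      simp
      nlinarith
  have hTk : Tendsto (fun k : ℕ => T ^ k) atTop (𝓝 0) :=
    tendsto_pow_of_spectralRadius_lt_one
      (by exact_mod_cast spectrum.spectralRadius_lt_of_forall_lt T (r := 1) hspec)
  have hstein : (P - T * P * Tᴴ).PosSemidef := by
    have e : P - T * P * Tᴴ = (2 : ℂ) • ((K * B) * (K * B)ᴴ) := by
      have e1 : P = K * ((1 - A) * P * (1 - A)ᴴ) * Kᴴ := by
        calc P = (K * (1 - A)) * P * (K * (1 - A))ᴴ := by rw [hKl]; simp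
          _ = _ := by simp only [Matrix.conjTranspose_mul, mul_assoc]
      have e2 : T * P * Tᴴ = K * ((1 + A) * P * (1 + A)ᴴ) * Kᴴ := by
        rw [hT']
        simp only [Matrix.conjTranspose_mul, mul_assoc]
      have e3 : (1 - A) * P * (1 - A)ᴴ - (1 + A) * P * (1 + A)ᴴ = (2 : ℂ) • (B * Bᴴ) := by
        rw [← neg_eq_of_add_eq_zero_right h, Matrix.conjTranspose_sub, Matrix.conjTranspose_add,
          Matrix.conjTranspose_one, two_smul]
        noncomm_ring
      calc P - T * P * Tᴴ = K * ((1 - A) * P * (1 - A)ᴴ - (1 + A) * P * (1 + A)ᴴ) * Kᴴ := by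
            rw [mul_sub, sub_mul, ← e1, ← e2]
        _ = _ := by
            rw [e3, Matrix.conjTranspose_mul]
            simp only [Matrix.mul_smul, Matrix.smul_mul, Matrix.mul_assoc]
    rw [e]
    exact (Matrix.posSemidef_self_mul_conjTranspose _).smul (by norm_num)
  -- The Stein inequality telescopes; since Tᵏ → 0, the diagonal of P dominates a sequence tending
  -- to 0.
  have hpow : ∀ k : ℕ, (P - T ^ k * P * (T ^ k)ᴴ).PosSemidef := by
    intro k
    induction k with
    | zero => simpa using Matrix.PosSemidef.zero
    | succ k ih =>
      have e : P - T ^ (k + 1) * P * (T ^ (k + 1))ᴴ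
          = (P - T ^ k * P * (T ^ k)ᴴ) + T ^ k * (P - T * P * Tᴴ) * (T ^ k)ᴴ := by
        rw [pow_succ, Matrix.conjTranspose_mul]
        noncomm_ring
      rw [e]
      exact ih.add (hstein.mul_mul_conjTranspose_same _)
  have hlim : Tendsto (fun k : ℕ => (T ^ k * P * (T ^ k)ᴴ) i i) atTop (𝓝 0) := by
    have hc : Continuous fun X : Matrix (Fin n) (Fin n) ℂ => (X * P * Xᴴ) i i := by fun_prop
    have := (hc.tendsto 0).comp hTk
    simpa [Function.comp_def] using this
  have hre := (Complex.continuous_re.tendsto _).comp hlim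
  refine le_of_tendsto hre (Eventually.of_forall fun k => ?_)
  have := (Complex.le_def.1 ((hpow k).diag_nonneg (i := i))).1
  simpa [hP] using this

theorem Matrix.eventually_isUnit_smul_one_sub {n : ℕ} (A : Matrix (Fin n) (Fin n) ℂ) (z : ℂ) :
    ∀ᶠ s in 𝓝[≠] z, IsUnit (s • (1 : Matrix (Fin n) (Fin n) ℂ) - A) := by
  have hf : ((spectrum ℂ A) \ {z}).Finite := A.finite_spectrum.sdiff
  have h1 : ((spectrum ℂ A) \ {z})ᶜ ∈ 𝓝 z := hf.isClosed.isOpen_compl.mem_nhds (by simp)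
  filter_upwards [mem_nhdsWithin_of_mem_nhds h1, self_mem_nhdsWithin] with s hs hsz
  by_contra hcon
  exact hs ⟨by rwa [← Algebra.algebraMap_eq_smul_one] at hcon, hsz⟩

end MatrixLemmas

/-! ### Balanced truncation, one state at a time. -/

/-- The inverse of a leading principal submatrix of codimension one. -/
theorem Matrix.inv_submatrix_castSucc {n : ℕ} {Q : Matrix (Fin (n + 1)) (Fin (n + 1)) ℂ}
    (hQ : IsUnit Q) (hQ' : IsUnit (Q.submatrix Fin.castSucc Fin.castSucc)) :
    Q⁻¹ (Fin.last n) (Fin.last n) ≠ 0 ∧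
    (Q.submatrix Fin.castSucc Fin.castSucc)⁻¹ = (Q⁻¹ - (Q⁻¹ (Fin.last n) (Fin.last n))⁻¹ •
      Matrix.vecMulVec (fun i => Q⁻¹ i (Fin.last n)) (fun j => Q⁻¹ (Fin.last n) j)).submatrix
        Fin.castSucc Fin.castSucc := by
  have hdet := (Matrix.isUnit_iff_isUnit_det _).1 hQ
  have hQR : Q * Q⁻¹ = 1 := Matrix.mul_nonsing_inv _ hdet
  have hRQ : Q⁻¹ * Q = 1 := Matrix.nonsing_inv_mul _ hdet
  set R := Q⁻¹ with hR
  have key : ∀ i j, ∑ k : Fin n, Q i k.castSucc * R k.castSucc j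
      = (1 : Matrix _ _ ℂ) i j - Q i (Fin.last n) * R (Fin.last n) j := by
    intro i j
    have := congrFun (congrFun hQR i) j
    rw [Matrix.mul_apply, Fin.sum_univ_castSucc] at this
    rw [← this]; ring
  -- If the corner entry vanished, the rest of the last column of R would lie in the kernel of the
  -- invertible leading block; the last column of R would then be zero.
  have hα : R (Fin.last n) (Fin.last n) ≠ 0 := by
    intro h0
    have hv : (Q.submatrix Fin.castSucc Fin.castSucc) *ᵥ (fun k : Fin n => R k.castSucc (Fin.last n))
        = 0 := by
      ext i
      have := key i.castSucc (Fin.last n)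
      rw [h0, mul_zero, sub_zero, Matrix.one_apply_ne (Fin.castSucc_lt_last i).ne] at this
      simpa [Matrix.mulVec, dotProduct] using this
    have hv0 : (fun k : Fin n => R k.castSucc (Fin.last n)) = 0 := by
      have hd := (Matrix.isUnit_iff_isUnit_det _).1 hQ'
      have := congrArg (fun v => (Q.submatrix Fin.castSucc Fin.castSucc)⁻¹ *ᵥ v) hv
      simpa [Matrix.mulVec_mulVec, Matrix.nonsing_inv_mul _ hd] using this
    have := key (Fin.last n) (Fin.last n)
    rw [h0] at this
    simp [congrFun hv0] at this
  refine ⟨hα, Matrix.inv_eq_right_inv ?_⟩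
  ext i j
  have h1 := key i.castSucc j.castSucc
  have h2 := key i.castSucc (Fin.last n)
  rw [Matrix.one_apply_ne (Fin.castSucc_lt_last i).ne] at h2
  simp only [Matrix.mul_apply, Matrix.submatrix_apply, Matrix.sub_apply, Matrix.smul_apply,
    Matrix.vecMulVec_apply, smul_eq_mul, mul_sub, Finset.sum_sub_distrib]
  have h3 : ∑ x : Fin n, Q i.castSucc x.castSucc * ((R (Fin.last n) (Fin.last n))⁻¹ *
      (R x.castSucc (Fin.last n) * R (Fin.last n) j.castSucc))
      = (∑ x : Fin n, Q i.castSucc x.castSucc * R x.castSucc (Fin.last n)) *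
        ((R (Fin.last n) (Fin.last n))⁻¹ * R (Fin.last n) j.castSucc) := by
    rw [Finset.sum_mul]
    exact Finset.sum_congr rfl fun _ _ => by ring
  rw [h3, h1, h2]
  simp only [Matrix.one_apply, Fin.castSucc_inj]
  field_simp
  ring

theorem sigmaMax_smul {p m : ℕ} (a : ℂ) (M : Matrix (Fin p) (Fin m) ℂ) :
    sigmaMax (a • M) = ‖a‖ * sigmaMax M := by
  simp only [sigmaMax, map_smul, norm_smul]

namespace LTISystem

variable {n m p : ℕ}

/-- The truncation of a realization to its first `r` states. -/
def truncate (S : LTISystem n m p) {r : ℕ} (h : r ≤ n) : LTISystem r m p where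
  A := S.A.submatrix (Fin.castLE h) (Fin.castLE h)
  B := S.B.submatrix (Fin.castLE h) id
  C := S.C.submatrix id (Fin.castLE h)
  D := S.D

theorem truncate_self (S : LTISystem n m p) : S.truncate le_rfl = S := by
  cases S
  simp [truncate]

theorem truncate_truncate (S : LTISystem n m p) {k r : ℕ} (hk : k ≤ n) (hr : r ≤ k) :
    (S.truncate hk).truncate hr = S.truncate (hr.trans hk) := rfl

/-- Since Σ is diagonal, entry (i, j) of each Lyapunov equation involves no entries of A beyond
those at (i, j) and (j, i), so the equations restrict to leading blocks. -/
theorem IsBalanced.truncate {S : LTISystem n m p} {σ : Fin n → ℝ} (h : S.IsBalanced σ)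
    {k : ℕ} (hk : k ≤ n) : (S.truncate hk).IsBalanced (fun i => σ (Fin.castLE hk i)) := by
  constructor
  · ext i j
    have := congrFun (congrFun h.1 (Fin.castLE hk i)) (Fin.castLE hk j)
    rw [Matrix.add_apply, Matrix.add_apply, Matrix.mul_diagonal, Matrix.diagonal_mul] at this ⊢
    exact this
  · ext i j
    have := congrFun (congrFun h.2 (Fin.castLE hk i)) (Fin.castLE hk j)
    rw [Matrix.add_apply, Matrix.add_apply, Matrix.mul_diagonal, Matrix.diagonal_mul] at this ⊢
    exact this

/-- Removing the last state of a balanced realization changes the frequency response by at most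
twice the corresponding diagonal entry of the Gramian. -/
theorem IsBalanced.sigmaMax_transfer_sub_truncate_le {S : LTISystem (n + 1) m p}
    {σ : Fin (n + 1) → ℝ} (h : S.IsBalanced σ) {s : ℂ} (hs : s.re = 0)
    (hA : IsUnit (s • (1 : Matrix (Fin (n + 1)) (Fin (n + 1)) ℂ) - S.A))
    (hA' : IsUnit (s • (1 : Matrix (Fin n) (Fin n) ℂ) - (S.truncate n.le_succ).A)) :
    sigmaMax (S.transfer s - (S.truncate n.le_succ).transfer s) ≤ 2 * |σ (Fin.last n)| := by
  set Q := s • (1 : Matrix (Fin (n + 1)) (Fin (n + 1)) ℂ) - S.A with hQ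
  have hsub : s • (1 : Matrix (Fin n) (Fin n) ℂ) - (S.truncate n.le_succ).A
      = Q.submatrix Fin.castSucc Fin.castSucc := by
    ext i j
    simp only [hQ, Matrix.sub_apply, Matrix.smul_apply, Matrix.one_apply,
      Matrix.submatrix_apply, Fin.castSucc_inj]
    rfl
  rw [hsub] at hA'
  obtain ⟨hα, hinv⟩ := Matrix.inv_submatrix_castSucc hA hA'
  have hdet := (Matrix.isUnit_iff_isUnit_det _).1 hA
  have hQR : Q * Q⁻¹ = 1 := Matrix.mul_nonsing_inv _ hdet
  have hRQ : Q⁻¹ * Q = 1 := Matrix.nonsing_inv_mul _ hdet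
  set R := Q⁻¹ with hR
  set α := R (Fin.last n) (Fin.last n) with hαdef
  set c : Matrix (Fin p) (Fin 1) ℂ := (S.C * R).submatrix id (fun _ => Fin.last n) with hc
  set b : Matrix (Fin 1) (Fin m) ℂ := (R * S.B).submatrix (fun _ => Fin.last n) id with hb
  have hE : S.transfer s - (S.truncate n.le_succ).transfer s = α⁻¹ • (c * b) := by
    have h1 : (S.truncate n.le_succ).transfer s = S.C * (R - α⁻¹ •
        Matrix.vecMulVec (fun i => R i (Fin.last n)) (fun j => R (Fin.last n) j)) * S.B + S.D := by
      rw [transfer, hsub, hinv]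
      congr 1
      ext i j
      set W := R - α⁻¹ • Matrix.vecMulVec (fun i => R i (Fin.last n)) (fun j => R (Fin.last n) j)
        with hW
      -- The rank-one correction kills the last row and column of W, so sums over n + 1 states
      -- collapse to the first n.
      have hl : ∀ j, W (Fin.last n) j = 0 := fun j => by
        simp [hW, Matrix.vecMulVec_apply, ← hαdef, hα]
      have hr : ∀ i, W i (Fin.last n) = 0 := fun i => by
        simp only [hW, Matrix.sub_apply, Matrix.smul_apply, Matrix.vecMulVec_apply, ← hαdef,
          smul_eq_mul]
        field_simp
        ring
      simp only [Matrix.mul_apply, Fin.sum_univ_castSucc, hl, hr, mul_zero, zero_mul, add_zero,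
        Finset.sum_const_zero]
      rfl
    have h2 : c * b = S.C * Matrix.vecMulVec (fun i => R i (Fin.last n))
        (fun j => R (Fin.last n) j) * S.B := by
      rw [Matrix.mul_vecMulVec, Matrix.vecMulVec_mul]
      ext i j
      simp [hc, hb, Matrix.mul_apply, Matrix.vecMulVec_apply, Matrix.mulVec, Matrix.vecMul,
        dotProduct]
    rw [h1, h2, transfer, ← hQ, ← hR, Matrix.mul_sub, Matrix.sub_mul, Matrix.mul_smul, Matrix.smul_mul]
    abel
  set P := Matrix.diagonal (fun i => (σ i : ℂ)) with hP
  -- On the imaginary axis the terms in s cancel from Q * P + P * Qᴴ, leaving the Lyapunov equation.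
  have hstar : star s = -s := by
    apply Complex.ext <;> simp [hs]
  have hQH : Qᴴ = -(s • 1) - S.Aᴴ := by
    rw [hQ, Matrix.conjTranspose_sub, Matrix.conjTranspose_smul, Matrix.conjTranspose_one, hstar,
      neg_smul]
  have hQP : Q * P + P * Qᴴ = S.B * S.Bᴴ := by
    rw [hQH, hQ, ← sub_eq_zero, ← neg_eq_zero, ← h.1]
    simp only [sub_mul, mul_sub, mul_neg, Matrix.smul_mul, Matrix.mul_smul, one_mul, mul_one]
    abel
  have hQP' : Qᴴ * P + P * Q = S.Cᴴ * S.C := by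
    rw [hQH, hQ, ← sub_eq_zero, ← neg_eq_zero, ← h.2]
    simp only [sub_mul, mul_sub, neg_mul, Matrix.smul_mul, Matrix.mul_smul, one_mul, mul_one]
    abel
  have hQRH : Qᴴ * Rᴴ = 1 := by rw [← Matrix.conjTranspose_mul, hRQ, Matrix.conjTranspose_one]
  have hRQH : Rᴴ * Qᴴ = 1 := by rw [← Matrix.conjTranspose_mul, hQR, Matrix.conjTranspose_one]
  have hgram : (R * S.B) * (R * S.B)ᴴ = P * Rᴴ + R * P := by
    calc (R * S.B) * (R * S.B)ᴴ = R * (S.B * S.Bᴴ) * Rᴴ := by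
          simp only [Matrix.conjTranspose_mul, Matrix.mul_assoc]
      _ = (R * Q) * P * Rᴴ + R * P * (Qᴴ * Rᴴ) := by rw [← hQP]; noncomm_ring
      _ = P * Rᴴ + R * P := by rw [hRQ, hQRH, one_mul, mul_one]
  have hgram' : (S.C * R)ᴴ * (S.C * R) = P * R + Rᴴ * P := by
    calc (S.C * R)ᴴ * (S.C * R) = Rᴴ * (S.Cᴴ * S.C) * R := by
          simp only [Matrix.conjTranspose_mul, Matrix.mul_assoc]
      _ = (Rᴴ * Qᴴ) * P * R + Rᴴ * P * (Q * R) := by rw [← hQP']; noncomm_ring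
      _ = P * R + Rᴴ * P := by rw [hRQH, hQR, one_mul, mul_one]
  have hαre : (σ (Fin.last n) : ℂ) * star α + α * σ (Fin.last n)
      = ((2 * σ (Fin.last n) * α.re : ℝ) : ℂ) := by
    apply Complex.ext <;> simp <;> ring
  have hb2 : (b * bᴴ) 0 0 = ((2 * σ (Fin.last n) * α.re : ℝ) : ℂ) := by
    have := congrFun (congrFun hgram (Fin.last n)) (Fin.last n)
    rw [Matrix.add_apply, hP, Matrix.diagonal_mul, Matrix.mul_diagonal, Matrix.conjTranspose_apply,
      ← hαdef, hαre] at this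
    rw [← this]
    rfl
  have hc2 : (cᴴ * c) 0 0 = ((2 * σ (Fin.last n) * α.re : ℝ) : ℂ) := by
    have := congrFun (congrFun hgram' (Fin.last n)) (Fin.last n)
    rw [Matrix.add_apply, hP, Matrix.diagonal_mul, Matrix.mul_diagonal, Matrix.conjTranspose_apply,
      ← hαdef] at this
    rw [← hαre]
    refine Eq.trans this ?_
    ring
  rw [hE, sigmaMax_smul, norm_inv, inv_mul_le_iff₀ (norm_pos_iff.2 hα)]
  refine (sigmaMax_mul_col_row_le c b hc2 hb2).trans ?_
  rw [abs_mul, abs_mul, abs_two, mul_comm]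
  exact mul_le_mul_of_nonneg_right (Complex.abs_re_le_norm α) (by positivity)

/-- The frequency-wise error bound of balanced truncation. -/
theorem IsBalanced.sigmaMax_transfer_sub_le {S : LTISystem n m p} {σ : Fin n → ℝ}
    (h : S.IsBalanced σ) (hσ : ∀ i, 0 ≤ σ i) {r : ℕ} (hr : r ≤ n) {s : ℂ} (hs : s.re = 0)
    (hA : ∀ (k : ℕ) (hk : k ≤ n), IsUnit (s • (1 : Matrix (Fin k) (Fin k) ℂ) - (S.truncate hk).A)) :
    sigmaMax (S.transfer s - (S.truncate hr).transfer s)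
      ≤ 2 * ∑ i ∈ Finset.univ.filter (fun i : Fin n => r ≤ (i : ℕ)), σ i := by
  induction n with
  | zero =>
    obtain rfl : r = 0 := by omega
    rw [truncate_self, sub_self, sigmaMax_zero]
    simp
  | succ n ih =>
    rcases Nat.eq_or_lt_of_le hr with rfl | hlt
    · rw [truncate_self, sub_self, sigmaMax_zero]
      exact mul_nonneg zero_le_two (Finset.sum_nonneg fun i _ => hσ i)
    · have hrn : r ≤ n := by omega
      have h1 := h.sigmaMax_transfer_sub_truncate_le hs
        (by simpa [truncate_self] using hA (n + 1) le_rfl) (hA n n.le_succ)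
      have h2 := ih (S := S.truncate n.le_succ) (h.truncate n.le_succ)
        (fun i => hσ _) hrn (fun k hk => hA k (hk.trans n.le_succ))
      rw [truncate_truncate] at h2
      -- The state just removed contributes the last summand; the induction hypothesis supplies the
      -- others.
      refine (sigmaMax_sub_le _ _ _).trans ((add_le_add h1 h2).trans_eq ?_)
      rw [abs_of_nonneg (hσ _), Finset.sum_filter, Finset.sum_filter, Fin.sum_univ_castSucc]
      simp only [Fin.val_castSucc, Fin.val_last, hrn, if_true]
      rw [mul_add, add_comm]
      rfl

end LTISystem

/-! ### Limits and removable singularities of transfer functions. -/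

theorem Matrix.tendsto_inv_of_isUnit {k : ℕ} {ι : Type*} {l : Filter ι}
    {f : ι → Matrix (Fin k) (Fin k) ℂ} {L : Matrix (Fin k) (Fin k) ℂ} (hL : IsUnit L)
    (hf : Tendsto f l (𝓝 L)) : Tendsto (fun x => (f x)⁻¹) l (𝓝 L⁻¹) := by
  have hd : L.det ≠ 0 := ((Matrix.isUnit_iff_isUnit_det _).1 hL).ne_zero
  simp only [Matrix.inv_def, Ring.inverse_eq_inv]
  have h1 : Tendsto (fun x => (f x).det) l (𝓝 L.det) :=
    ((continuous_id.matrix_det).tendsto L).comp hf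
  have h2 : Tendsto (fun x => (f x).adjugate) l (𝓝 L.adjugate) :=
    ((continuous_id.matrix_adjugate).tendsto L).comp hf
  exact (h1.inv₀ hd).smul h2

theorem Matrix.meromorphicAt_det {k : ℕ} {f : ℂ → Matrix (Fin k) (Fin k) ℂ} {z : ℂ}
    (hf : ∀ i j, MeromorphicAt (fun s => f s i j) z) : MeromorphicAt (fun s => (f s).det) z := by
  simp only [Matrix.det_apply]
  refine MeromorphicAt.fun_sum fun g _ => ?_
  have h := (MeromorphicAt.fun_prod (s := Finset.univ) fun i _ => hf (g i) i).const_smul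
    ((Equiv.Perm.sign g : ℤ) : ℂ)
  refine h.congr (Eventually.of_forall fun s => ?_)
  simp [Units.smul_def]

theorem Matrix.meromorphicAt_inv_apply {k : ℕ} {f : ℂ → Matrix (Fin k) (Fin k) ℂ} {z : ℂ}
    (hf : ∀ i j, MeromorphicAt (fun s => f s i j) z) (i j : Fin k) :
    MeromorphicAt (fun s => (f s)⁻¹ i j) z := by
  simp only [Matrix.inv_def, Ring.inverse_eq_inv, Matrix.smul_apply, smul_eq_mul,
    Matrix.adjugate_apply]
  refine (Matrix.meromorphicAt_det hf).inv.mul (Matrix.meromorphicAt_det fun a b => ?_)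
  by_cases h : a = j
  · subst h
    simp
  · simpa [Matrix.updateRow_ne h] using hf a b

theorem tendsto_I_mul_ofReal_nhdsNE (ω : ℝ) :
    Tendsto (fun x : ℝ => Complex.I * (x : ℂ)) (𝓝[≠] ω) (𝓝[≠] (Complex.I * (ω : ℂ))) := by
  refine tendsto_nhdsWithin_of_tendsto_nhds_of_eventually_within _ ?_ ?_
  · have hc : Continuous fun x : ℝ => Complex.I * (x : ℂ) := by fun_prop
    exact (hc.tendsto ω).mono_left nhdsWithin_le_nhds
  · filter_upwards [self_mem_nhdsWithin] with x hx
    simpa using hx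

namespace LTISystem

variable {n m p : ℕ}

theorem tendsto_transfer (S : LTISystem n m p) {ι : Type*} {l : Filter ι} {f : ι → ℂ} {z : ℂ}
    (hz : IsUnit (z • (1 : Matrix (Fin n) (Fin n) ℂ) - S.A)) (hf : Tendsto f l (𝓝 z)) :
    Tendsto (fun x => S.transfer (f x)) l (𝓝 (S.transfer z)) := by
  have h1 : Tendsto (fun x => f x • (1 : Matrix (Fin n) (Fin n) ℂ) - S.A) l
      (𝓝 (z • (1 : Matrix (Fin n) (Fin n) ℂ) - S.A)) := (hf.smul_const _).sub_const _
  have h2 := Matrix.tendsto_inv_of_isUnit hz h1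
  have hc : Continuous fun X : Matrix (Fin n) (Fin n) ℂ => S.C * X * S.B + S.D := by fun_prop
  exact (hc.tendsto _).comp h2

theorem hasFreqResponse_transfer (S : LTISystem n m p) {ω : ℝ}
    (hz : IsUnit ((Complex.I * (ω : ℂ)) • (1 : Matrix (Fin n) (Fin n) ℂ) - S.A)) :
    S.HasFreqResponse ω (S.transfer (Complex.I * (ω : ℂ))) :=
  S.tendsto_transfer hz (tendsto_id.mono_left nhdsWithin_le_nhds)

theorem IsHurwitz.isUnit {S : LTISystem n m p} (h : S.IsHurwitz) {z : ℂ} (hz : 0 ≤ z.re) :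
    IsUnit (z • (1 : Matrix (Fin n) (Fin n) ℂ) - S.A) := by
  by_contra hcon
  rw [← Algebra.algebraMap_eq_smul_one] at hcon
  exact absurd (h z hcon) (not_lt.2 hz)

theorem meromorphicAt_transfer_apply (S : LTISystem n m p) (z : ℂ) (i : Fin p) (j : Fin m) :
    MeromorphicAt (fun s => S.transfer s i j) z := by
  have hinv : ∀ a b, MeromorphicAt
      (fun s => (s • (1 : Matrix (Fin n) (Fin n) ℂ) - S.A)⁻¹ a b) z :=
    Matrix.meromorphicAt_inv_apply fun a b =>
      ((MeromorphicAt.id z).mul (MeromorphicAt.const _ z)).sub (MeromorphicAt.const _ z)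
  simp only [transfer, Matrix.add_apply, Matrix.mul_apply]
  refine MeromorphicAt.add (MeromorphicAt.fun_sum fun b _ => MeromorphicAt.mul
    (MeromorphicAt.fun_sum fun a _ => (MeromorphicAt.const _ z).mul (hinv a b))
    (MeromorphicAt.const _ z)) (MeromorphicAt.const _ z)

/-- A transfer function that is bounded along the imaginary axis near `jω` is finite at `jω`. -/
theorem exists_hasFreqResponse_of_bounded (S : LTISystem n m p) {ω K : ℝ}
    (h : ∀ᶠ x : ℝ in 𝓝[≠] ω, sigmaMax (S.transfer (Complex.I * (x : ℂ))) ≤ K) :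
    ∃ N, S.HasFreqResponse ω N := by
  have hentry : ∀ i j, ∃ c, Tendsto (fun s => S.transfer s i j) (𝓝[≠] (Complex.I * (ω : ℂ)))
      (𝓝 c) := by
    intro i j
    have hm := S.meromorphicAt_transfer_apply (Complex.I * (ω : ℂ)) i j
    -- A meromorphic function without a finite limit tends to infinity from every direction, so
    -- boundedness along the axis alone excludes a pole.
    rw [tendsto_nhds_iff_meromorphicOrderAt_nonneg hm, ← not_lt,
      ← tendsto_cobounded_iff_meromorphicOrderAt_neg hm, ← tendsto_norm_atTop_iff_cobounded]
    intro hcob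
    obtain ⟨L, hL0, hL⟩ := exists_norm_entry_le_sigmaMax (p := p) (m := m) i j
    have h1 := (hcob.comp (tendsto_I_mul_ofReal_nhdsNE ω)).eventually_gt_atTop (L * K)
    obtain ⟨x, hx1, hx2⟩ := (h1.and h).exists
    exact absurd hx1 (not_lt.2 ((hL _).trans (mul_le_mul_of_nonneg_left hx2 hL0)))
  choose N hN using hentry
  exact ⟨N, tendsto_pi_nhds.2 fun i => tendsto_pi_nhds.2 fun j => hN i j⟩

/-- The error bound of balanced truncation at every frequency, with removable singularities of the
truncated system filled in. -/
theorem IsBalanced.exists_hasFreqResponse_truncate {S : LTISystem n m p} {σ : Fin n → ℝ}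
    (h : S.IsBalanced σ) (hS : S.IsHurwitz) {r : ℕ} (hr : r ≤ n) (ω : ℝ) :
    ∃ N, (S.truncate hr).HasFreqResponse ω N ∧
      sigmaMax (S.transfer (Complex.I * (ω : ℂ)) - N)
        ≤ 2 * ∑ i ∈ Finset.univ.filter (fun i : Fin n => r ≤ (i : ℕ)), σ i := by
  set K := 2 * ∑ i ∈ Finset.univ.filter (fun i : Fin n => r ≤ (i : ℕ)), σ i
  have hσ : ∀ i, 0 ≤ σ i := nonneg_of_lyapunov hS h.1
  -- Truncations may have eigenvalues on the axis, but only finitely many; the stepwise bound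
  -- therefore holds at all nearby frequencies.
  have hunit : ∀ᶠ s in 𝓝[≠] (Complex.I * (ω : ℂ)), ∀ k : Fin (n + 1),
      IsUnit (s • (1 : Matrix (Fin k) (Fin k) ℂ) - (S.truncate (Nat.lt_succ_iff.1 k.2)).A) :=
    eventually_all.2 fun k => Matrix.eventually_isUnit_smul_one_sub _ _
  have hbound : ∀ᶠ x : ℝ in 𝓝[≠] ω, sigmaMax (S.transfer (Complex.I * (x : ℂ))
      - (S.truncate hr).transfer (Complex.I * (x : ℂ))) ≤ K := by
    filter_upwards [(tendsto_I_mul_ofReal_nhdsNE ω).eventually hunit] with x hx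
    exact h.sigmaMax_transfer_sub_le hσ hr (by simp) fun k hk => hx ⟨k, Nat.lt_succ_iff.2 hk⟩
  have hlim : Tendsto (fun x : ℝ => S.transfer (Complex.I * (x : ℂ))) (𝓝[≠] ω)
      (𝓝 (S.transfer (Complex.I * (ω : ℂ)))) :=
    (S.hasFreqResponse_transfer (hS.isUnit (by simp))).comp (tendsto_I_mul_ofReal_nhdsNE ω)
  have hbdd := ((continuous_sigmaMax.tendsto _).comp hlim).eventually_lt_const (lt_add_one _)
  obtain ⟨N, hN⟩ := (S.truncate hr).exists_hasFreqResponse_of_bounded (ω := ω)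
    (K := K + (sigmaMax (S.transfer (Complex.I * (ω : ℂ))) + 1)) (by
      filter_upwards [hbound, hbdd] with x h1 h2
      have h3 := sigmaMax_sub_le ((S.truncate hr).transfer (Complex.I * (x : ℂ)))
        (S.transfer (Complex.I * (x : ℂ))) 0
      rw [sub_zero, sub_zero, sigmaMax_sub_comm] at h3
      exact h3.trans (add_le_add h1 h2.le))
  exact ⟨N, hN, le_of_tendsto ((continuous_sigmaMax.tendsto _).comp
    (hlim.sub (hN.comp (tendsto_I_mul_ofReal_nhdsNE ω)))) hbound⟩

/-! ### The supremum norm and infinite frequency. -/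

theorem ofReal_sigmaMax_sub_le_supNormDiff {n' : ℕ} {S : LTISystem n m p} {T : LTISystem n' m p}
    {ω : ℝ} {M N : Matrix (Fin p) (Fin m) ℂ} (hM : S.HasFreqResponse ω M)
    (hN : T.HasFreqResponse ω N) : ENNReal.ofReal (sigmaMax (M - N)) ≤ S.supNormDiff T :=
  le_iSup_of_le ω <| le_iSup_of_le M <| le_iSup_of_le N <| le_iSup_of_le hM <|
    le_iSup_of_le hN le_rfl

theorem eventually_isUnit_and_tendsto_transfer_atTop (S : LTISystem n m p) :
    (∀ᶠ ω : ℝ in atTop,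
      IsUnit ((Complex.I * (ω : ℂ)) • (1 : Matrix (Fin n) (Fin n) ℂ) - S.A)) ∧
    Tendsto (fun ω : ℝ => S.transfer (Complex.I * (ω : ℂ))) atTop (𝓝 S.D) := by
  have hu : Tendsto (fun ω : ℝ => (Complex.I * (ω : ℂ))⁻¹) atTop (𝓝 0) := by
    have h1 : Tendsto (fun ω : ℝ => ((ω⁻¹ : ℝ) : ℂ)) atTop (𝓝 0) := by
      exact (Complex.continuous_ofReal.tendsto 0).comp tendsto_inv_atTop_zero
    simpa [mul_inv, mul_comm] using h1.const_mul (Complex.I⁻¹)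
  have hf : Tendsto (fun ω : ℝ => (1 : Matrix (Fin n) (Fin n) ℂ) - (Complex.I * (ω : ℂ))⁻¹ • S.A)
      atTop (𝓝 1) := by
    simpa using (hu.smul_const S.A).const_sub 1
  have hinv := Matrix.tendsto_inv_of_isUnit isUnit_one hf
  have hunit : ∀ᶠ ω : ℝ in atTop,
      IsUnit ((1 : Matrix (Fin n) (Fin n) ℂ) - (Complex.I * (ω : ℂ))⁻¹ • S.A) := by
    have hd := ((continuous_id.matrix_det).tendsto (1 : Matrix (Fin n) (Fin n) ℂ)).comp hf
    simp only [id_eq, Matrix.det_one] at hd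
    filter_upwards [hd.eventually_ne one_ne_zero] with ω hω
    exact (Matrix.isUnit_iff_isUnit_det _).2 (isUnit_iff_ne_zero.2 hω)
  have hfac : ∀ ω : ℝ, 0 < ω → (Complex.I * (ω : ℂ)) • (1 : Matrix (Fin n) (Fin n) ℂ) - S.A
      = (Complex.I * (ω : ℂ)) • (1 - (Complex.I * (ω : ℂ))⁻¹ • S.A) := fun ω hω => by
    rw [smul_sub, smul_smul, mul_inv_cancel₀ (by simp [hω.ne']), one_smul]
  constructor
  · filter_upwards [hunit, eventually_gt_atTop 0] with ω h1 h2
    rw [hfac ω h2]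
    exact h1.smul (Units.mk0 (Complex.I * (ω : ℂ)) (by simp [h2.ne']))
  · have hc : Continuous fun X : Matrix (Fin n) (Fin n) ℂ => S.C * X * S.B + S.D := by fun_prop
    have h0 : Tendsto (fun ω : ℝ => S.C * ((Complex.I * (ω : ℂ))⁻¹ •
        ((1 : Matrix (Fin n) (Fin n) ℂ) - (Complex.I * (ω : ℂ))⁻¹ • S.A)⁻¹) * S.B + S.D) atTop
        (𝓝 S.D) := by
      have h1 := (hc.tendsto _).comp (hu.smul hinv)
      rw [zero_smul, Matrix.mul_zero, Matrix.zero_mul, zero_add] at h1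
      exact h1
    refine h0.congr' ?_
    filter_upwards [hunit, eventually_gt_atTop 0] with ω h1 h2
    have hne : Complex.I * (ω : ℂ) ≠ 0 := by simp [h2.ne']
    have hd := (Matrix.isUnit_iff_isUnit_det _).1 h1
    rw [transfer, hfac ω h2]
    congr 3
    refine (Matrix.inv_eq_right_inv ?_).symm
    rw [Matrix.smul_mul, Matrix.mul_smul, smul_smul, mul_inv_cancel₀ hne, one_smul,
      Matrix.mul_nonsing_inv _ hd]

/-- The direct terms are the limits of the transfer functions along the axis, so a bound at all
large finite frequencies extends to infinity. -/
theorem ofReal_sigmaMax_D_sub_le_supNormDiff {n' : ℕ} (S : LTISystem n m p)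
    (T : LTISystem n' m p) : ENNReal.ofReal (sigmaMax (S.D - T.D)) ≤ S.supNormDiff T := by
  obtain ⟨h1, h2⟩ := S.eventually_isUnit_and_tendsto_transfer_atTop
  obtain ⟨h3, h4⟩ := T.eventually_isUnit_and_tendsto_transfer_atTop
  refine le_of_tendsto (((ENNReal.continuous_ofReal.comp continuous_sigmaMax).tendsto _).comp
    (h2.sub h4)) ?_
  filter_upwards [h1, h3] with ω h5 h6
  exact ofReal_sigmaMax_sub_le_supNormDiff (S.hasFreqResponse_transfer h5)
    (T.hasFreqResponse_transfer h6)

/-! ### The extended system as a Möbius substitution. -/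

theorem smul_one_sub_A_eq_shift_sub (S : LTISystem n m p) (ε ϖ : ℝ) (z : ℂ) :
    z • 1 - S.A = S.shift ε ϖ - (ε + Complex.I * ϖ - z) • 1 := by
  rw [shift, sub_smul, add_smul]
  abel

theorem extended_A_eq {S : LTISystem n m p} {ε ϖ : ℝ} (h : IsUnit (S.shift ε ϖ)) :
    (S.extended ε ϖ).A = (Complex.I * (ϖ : ℂ)) • 1 - (ε : ℂ) • 1
      + ((ε : ℂ) ^ 2) • (S.shift ε ϖ)⁻¹ := by
  have hd := (Matrix.isUnit_iff_isUnit_det _).1 h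
  have e : (Complex.I * (ϖ : ℂ)) • 1 - S.A = S.shift ε ϖ - (ε : ℂ) • 1 := by
    rw [smul_one_sub_A_eq_shift_sub S ε ϖ]; congr 2; ring
  simp only [extended]
  rw [e, mul_sub, Matrix.nonsing_inv_mul _ hd, Matrix.mul_smul, mul_one, smul_sub, smul_smul, ← sq]
  abel

/-- The extended system evaluates the original transfer function at a Möbius transform. -/
theorem transfer_extended {S : LTISystem n m p} {ε ϖ : ℝ} (h : IsUnit (S.shift ε ϖ)) {s z : ℂ}
    (hτ : s - Complex.I * ϖ + ε ≠ 0)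
    (hsz : (z - Complex.I * ϖ) * (s - Complex.I * ϖ + ε) = ε * (s - Complex.I * ϖ))
    (hz : IsUnit (z • (1 : Matrix (Fin n) (Fin n) ℂ) - S.A)) :
    (S.extended ε ϖ).transfer s = S.transfer z := by
  set τ := s - Complex.I * ϖ + ε with hτdef
  set X := S.shift ε ϖ with hX
  set Y := z • (1 : Matrix (Fin n) (Fin n) ℂ) - S.A with hY
  have hXd := (Matrix.isUnit_iff_isUnit_det _).1 h
  have hYd := (Matrix.isUnit_iff_isUnit_det _).1 hz
  have hXX : X⁻¹ * X = 1 := Matrix.nonsing_inv_mul _ hXd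
  have hXX' : X * X⁻¹ = 1 := Matrix.mul_nonsing_inv _ hXd
  have hYY : Y * Y⁻¹ = 1 := Matrix.mul_nonsing_inv _ hYd
  -- The relation between s and z says (ε + jϖ - z)τ = ε²; hence sI - A_ε = τX⁻¹Y, and the rest is
  -- the resolvent identity for X and Y.
  have hYX : Y + ((ε : ℂ) ^ 2 * τ⁻¹) • 1 = X := by
    have : (ε : ℂ) ^ 2 * τ⁻¹ = ε + Complex.I * ϖ - z := by
      field_simp
      linear_combination hsz + (ε : ℂ) * hτdef
    rw [hY, smul_one_sub_A_eq_shift_sub S ε ϖ, this, sub_add_cancel]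
  have hinv : (s • (1 : Matrix (Fin n) (Fin n) ℂ) - (S.extended ε ϖ).A)⁻¹
      = τ⁻¹ • (Y⁻¹ * X) := by
    apply Matrix.inv_eq_right_inv
    have e : s • (1 : Matrix (Fin n) (Fin n) ℂ) - (S.extended ε ϖ).A = τ • (X⁻¹ * Y) := by
      have : Y = X - ((ε : ℂ) ^ 2 * τ⁻¹) • 1 := by rw [← hYX, add_sub_cancel_right]
      rw [extended_A_eq h, this, mul_sub, hXX, Matrix.mul_smul, mul_one, smul_sub, smul_smul,
        mul_left_comm, mul_inv_cancel₀ hτ, mul_one, hτdef, add_smul, sub_smul]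
      abel
    rw [e, Matrix.smul_mul, Matrix.mul_smul, smul_smul, mul_inv_cancel₀ hτ, one_smul, mul_assoc,
      ← mul_assoc Y, hYY, one_mul, hXX]
  have hres : ((ε : ℂ) ^ 2 * τ⁻¹) • (X⁻¹ * Y⁻¹) + X⁻¹ = Y⁻¹ := by
    calc ((ε : ℂ) ^ 2 * τ⁻¹) • (X⁻¹ * Y⁻¹) + X⁻¹
        = X⁻¹ * (Y + ((ε : ℂ) ^ 2 * τ⁻¹) • 1) * Y⁻¹ := by
          rw [mul_add, add_mul, mul_assoc X⁻¹ Y, hYY, Matrix.mul_smul, Matrix.smul_mul, mul_one,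
            add_comm]
      _ = Y⁻¹ := by rw [hYX, hXX, one_mul]
  rw [transfer, hinv, transfer, ← hY]
  conv_rhs => rw [← hres]
  simp only [extended, ← hX, Matrix.smul_mul, Matrix.mul_smul, smul_smul, Matrix.mul_add,
    Matrix.add_mul]
  have e3 : S.C * X⁻¹ * (Y⁻¹ * X) * (X⁻¹ * S.B) = S.C * (X⁻¹ * Y⁻¹) * S.B := by
    calc S.C * X⁻¹ * (Y⁻¹ * X) * (X⁻¹ * S.B) = S.C * (X⁻¹ * Y⁻¹) * ((X * X⁻¹) * S.B) := by
          simp only [Matrix.mul_assoc]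
      _ = _ := by rw [hXX', Matrix.one_mul]
  rw [e3, show (ε : ℂ) * (τ⁻¹ * ε) = ε ^ 2 * τ⁻¹ by ring]
  abel

/-- A frequency response of the extended system at `jϖ` is one of the original system. -/
theorem hasFreqResponse_of_extended {S : LTISystem n m p} {ε ϖ : ℝ} (hε : 0 < ε)
    (h : IsUnit (S.shift ε ϖ)) {N : Matrix (Fin p) (Fin m) ℂ}
    (hN : (S.extended ε ϖ).HasFreqResponse ϖ N) : S.HasFreqResponse ϖ N := by
  have hε' : (ε : ℂ) ≠ 0 := by exact_mod_cast hε.ne'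
  set c : ℂ := Complex.I * (ϖ : ℂ) with hc
  have hlim0 : Tendsto (fun z : ℂ => (ε : ℂ) - (z - c)) (𝓝 c) (𝓝 ε) := by
    have : Continuous fun z : ℂ => (ε : ℂ) - (z - c) := by fun_prop
    simpa using this.tendsto c
  have hne : ∀ᶠ z in 𝓝[≠] c, (ε : ℂ) - (z - c) ≠ 0 :=
    (hlim0.eventually_ne hε').filter_mono nhdsWithin_le_nhds
  -- This is the inverse Möbius map z ↦ s. It must preserve punctured neighbourhoods of jϖ, because
  -- frequency responses are punctured limits.
  have hlim : Tendsto (fun z : ℂ => c + ε * (z - c) / (ε - (z - c))) (𝓝[≠] c) (𝓝[≠] c) := by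
    refine tendsto_nhdsWithin_of_tendsto_nhds_of_eventually_within _ ?_ ?_
    · have h1 : Tendsto (fun z : ℂ => (ε : ℂ) * (z - c)) (𝓝 c) (𝓝 0) := by
        have : Continuous fun z : ℂ => (ε : ℂ) * (z - c) := by fun_prop
        simpa using this.tendsto c
      have h2 := (h1.div hlim0 hε').const_add c
      simp only [zero_div, add_zero] at h2
      exact h2.mono_left nhdsWithin_le_nhds
    · filter_upwards [hne, self_mem_nhdsWithin] with z h1 h2
      have h3 : z - c ≠ 0 := sub_ne_zero.2 h2
      simp only [Set.mem_compl_iff, Set.mem_singleton_iff, add_eq_left]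
      exact div_ne_zero (mul_ne_zero hε' h3) h1
  refine (Tendsto.comp hN hlim).congr' ?_
  filter_upwards [hne, S.A.eventually_isUnit_smul_one_sub c] with z h1 h2
  have hτ : c + ε * (z - c) / (ε - (z - c)) - c + ε = ε ^ 2 / (ε - (z - c)) := by
    field_simp
    ring
  refine transfer_extended h ?_ ?_ h2
  · rw [← hc, hτ]
    exact div_ne_zero (pow_ne_zero 2 hε') h1
  · rw [← hc, hτ]
    field_simp
    ring

/-! ### The reduced model and truncation of the extended system. -/

theorem truncMatrix_mul {k r : ℕ} (hr : r ≤ n) (M : Matrix (Fin n) (Fin k) ℂ) :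
    truncMatrix r n * M = M.submatrix (Fin.castLE hr) id := by
  ext i j
  rw [Matrix.mul_apply, Finset.sum_eq_single (Fin.castLE hr i)]
  · simp [truncMatrix]
  · intro b _ hb
    have : (i : ℕ) ≠ b := fun h => hb (Fin.ext h.symm)
    simp [truncMatrix, this]
  · simp

theorem mul_truncMatrix_transpose {k r : ℕ} (hr : r ≤ n) (M : Matrix (Fin k) (Fin n) ℂ) :
    M * (truncMatrix r n)ᵀ = M.submatrix id (Fin.castLE hr) := by
  rw [← Matrix.transpose_transpose (M * _), Matrix.transpose_mul, Matrix.transpose_transpose,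
    truncMatrix_mul hr]
  rfl

/-- With W = εI - F, the shift is εI + εFW⁻¹ = ε(W + F)W⁻¹, and W + F = εI. This gives
well-posedness of the second extension and makes it undo the reduction formulas. -/
theorem reduced_shift_eq {S : LTISystem n m p} {ε ϖ : ℝ} {r : ℕ}
    (hred : IsUnit ((ε : ℂ) • (1 : Matrix (Fin r) (Fin r) ℂ) - S.truncShift ε ϖ r)) :
    (S.reduced ε ϖ r).shift ε ϖ
      = ((ε : ℂ) ^ 2) • ((ε : ℂ) • 1 - S.truncShift ε ϖ r)⁻¹ := by
  have hd := (Matrix.isUnit_iff_isUnit_det _).1 hred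
  set F := S.truncShift ε ϖ r
  set W := (ε : ℂ) • (1 : Matrix (Fin r) (Fin r) ℂ) - F with hW
  have hF : F = (ε : ℂ) • 1 - W := by rw [hW, sub_sub_cancel]
  simp only [shift, reduced, reducedA]
  change _ + _ - (_ - (ε : ℂ) • (F * W⁻¹)) = _
  rw [hF, sub_mul, Matrix.mul_nonsing_inv _ hd, Matrix.smul_mul, one_mul, smul_sub, smul_smul,
    ← sq]
  abel

theorem isUnit_reduced_shift {S : LTISystem n m p} {ε ϖ : ℝ} (hε : 0 < ε) {r : ℕ}
    (hred : IsUnit ((ε : ℂ) • (1 : Matrix (Fin r) (Fin r) ℂ) - S.truncShift ε ϖ r)) :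
    IsUnit ((S.reduced ε ϖ r).shift ε ϖ) := by
  have hε' : (ε : ℂ) ≠ 0 := by exact_mod_cast hε.ne'
  rw [reduced_shift_eq hred]
  exact ((Matrix.isUnit_nonsing_inv_iff).2 hred).smul (Units.mk0 ((ε : ℂ) ^ 2) (pow_ne_zero 2 hε'))

/-- The extended system of the reduced model is the balanced truncation of the extended system. -/
theorem extended_reduced {S : LTISystem n m p} {ε ϖ : ℝ} (hε : 0 < ε) {r : ℕ} (hr : r ≤ n)
    (hred : IsUnit ((ε : ℂ) • (1 : Matrix (Fin r) (Fin r) ℂ) - S.truncShift ε ϖ r)) :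
    (S.reduced ε ϖ r).extended ε ϖ = (S.extended ε ϖ).truncate hr := by
  have hε' : (ε : ℂ) ≠ 0 := by exact_mod_cast hε.ne'
  have hu := isUnit_reduced_shift hε hred
  have hXd := (Matrix.isUnit_iff_isUnit_det _).1 hu
  have hd := (Matrix.isUnit_iff_isUnit_det _).1 hred
  have hX1 := Matrix.nonsing_inv_mul _ hXd
  have hX2 := Matrix.mul_nonsing_inv _ hXd
  have hXinv : ((S.reduced ε ϖ r).shift ε ϖ)⁻¹
      = ((ε : ℂ) ^ 2)⁻¹ • ((ε : ℂ) • 1 - S.truncShift ε ϖ r) := by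
    apply Matrix.inv_eq_right_inv
    rw [reduced_shift_eq hred, Matrix.smul_mul, Matrix.mul_smul, smul_smul,
      mul_inv_cancel₀ (pow_ne_zero 2 hε'), one_smul, Matrix.nonsing_inv_mul _ hd]
  have hA : ((S.reduced ε ϖ r).extended ε ϖ).A = ((S.extended ε ϖ).truncate hr).A := by
    rw [extended_A_eq hu, hXinv, smul_smul, mul_inv_cancel₀ (pow_ne_zero 2 hε'), one_smul,
      truncShift, truncMatrix_mul hr, mul_truncMatrix_transpose hr]
    ext i j
    simp [truncate, Matrix.one_apply]
  have hB : ((S.reduced ε ϖ r).extended ε ϖ).B = ((S.extended ε ϖ).truncate hr).B := by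
    change (ε : ℂ) • (((S.reduced ε ϖ r).shift ε ϖ)⁻¹ * ((ε : ℂ)⁻¹ •
      ((S.reduced ε ϖ r).shift ε ϖ * (truncMatrix r n * (S.extended ε ϖ).B)))) = _
    rw [Matrix.mul_smul, smul_smul, mul_inv_cancel₀ hε', one_smul, ← Matrix.mul_assoc, hX1,
      Matrix.one_mul, truncMatrix_mul hr]
    rfl
  have hC : ((S.reduced ε ϖ r).extended ε ϖ).C = ((S.extended ε ϖ).truncate hr).C := by
    change (ε : ℂ) • (((ε : ℂ)⁻¹ • ((S.extended ε ϖ).C * (truncMatrix r n)ᵀ *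
      (S.reduced ε ϖ r).shift ε ϖ)) * ((S.reduced ε ϖ r).shift ε ϖ)⁻¹) = _
    rw [Matrix.smul_mul, smul_smul, mul_inv_cancel₀ hε', one_smul, Matrix.mul_assoc, hX2,
      Matrix.mul_one, mul_truncMatrix_transpose hr]
    rfl
  have hD : ((S.reduced ε ϖ r).extended ε ϖ).D = ((S.extended ε ϖ).truncate hr).D :=
    -- D_r subtracts exactly the term that the extension adds back.
    sub_add_cancel _ _
  cases h1 : (S.reduced ε ϖ r).extended ε ϖ
  cases h2 : (S.extended ε ϖ).truncate hr
  rw [h1, h2] at hA hB hC hD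
  simp only at hA hB hC hD
  rw [hA, hB, hC, hD]

end LTISystem

/-! ### The error bounds. -/

theorem theorem1 {n m p r : ℕ} (hr : r ≤ n) (S : LTISystem n m p) (ε ϖ : ℝ) (hε : 0 < ε)
    (hext : IsUnit (S.shift ε ϖ))
    (hstable : (S.extended ε ϖ).IsHurwitz)
    (σ : Fin n → ℝ) (hσ : Antitone σ)
    (hbal : (S.extended ε ϖ).IsBalanced σ)
    (hred : IsUnit ((ε : ℂ) • (1 : Matrix (Fin r) (Fin r) ℂ) - S.truncShift ε ϖ r)) :
    IsUnit ((S.reduced ε ϖ r).shift ε ϖ) ∧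
    (∃ M N : Matrix (Fin p) (Fin m) ℂ,
      S.HasFreqResponse ϖ M ∧ (S.reduced ε ϖ r).HasFreqResponse ϖ N ∧
      sigmaMax (M - N) ≤ 2 * ∑ i ∈ Finset.univ.filter (fun i : Fin n => r ≤ (i : ℕ)), σ i) ∧
    (∀ (ω : ℝ) (M N : Matrix (Fin p) (Fin m) ℂ),
      S.HasFreqResponse ω M → (S.reduced ε ϖ r).HasFreqResponse ω N →
      ENNReal.ofReal (sigmaMax (M - N)) ≤
        ENNReal.ofReal (2 * ∑ i ∈ Finset.univ.filter (fun i : Fin n => r ≤ (i : ℕ)), σ i)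
          + S.supNormDiff (S.extended ε ϖ)
          + (S.reduced ε ϖ r).supNormDiff ((S.reduced ε ϖ r).extended ε ϖ)) ∧
    ENNReal.ofReal (sigmaMax (S.D - (S.reduced ε ϖ r).D)) ≤
      ENNReal.ofReal (2 * ∑ i ∈ Finset.univ.filter (fun i : Fin n => r ≤ (i : ℕ)), σ i)
        + S.supNormDiff (S.extended ε ϖ)
        + (S.reduced ε ϖ r).supNormDiff ((S.reduced ε ϖ r).extended ε ϖ) := by
  have hu := LTISystem.isUnit_reduced_shift hε hred
  have hEr := LTISystem.extended_reduced hε hr hred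
  have hE : ∀ ω : ℝ, (S.extended ε ϖ).HasFreqResponse ω
      ((S.extended ε ϖ).transfer (Complex.I * (ω : ℂ))) := fun ω =>
    LTISystem.hasFreqResponse_transfer _ (hstable.isUnit (by simp))
  have hT : ∀ ω : ℝ, ∃ N, ((S.reduced ε ϖ r).extended ε ϖ).HasFreqResponse ω N ∧
      sigmaMax ((S.extended ε ϖ).transfer (Complex.I * (ω : ℂ)) - N)
        ≤ 2 * ∑ i ∈ Finset.univ.filter (fun i : Fin n => r ≤ (i : ℕ)), σ i := by
    rw [hEr]
    exact hbal.exists_hasFreqResponse_truncate hstable hr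
  refine ⟨hu, ?_, ?_, ?_⟩
  · obtain ⟨N, hN, hle⟩ := hT ϖ
    exact ⟨_, N, LTISystem.hasFreqResponse_of_extended hε hext (hE ϖ),
      LTISystem.hasFreqResponse_of_extended hε hu hN, hle⟩
  · intro ω M N hM hN
    obtain ⟨N', hN', hle⟩ := hT ω
    set G := (S.extended ε ϖ).transfer (Complex.I * (ω : ℂ))
    have h1 := LTISystem.ofReal_sigmaMax_sub_le_supNormDiff hM (hE ω)
    have h2 := LTISystem.ofReal_sigmaMax_sub_le_supNormDiff hN hN'
    rw [sigmaMax_sub_comm] at h2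
    have h3 : sigmaMax (M - N) ≤ sigmaMax (G - N') + sigmaMax (M - G) + sigmaMax (N' - N) := by
      linarith [sigmaMax_sub_le M G N, sigmaMax_sub_le G N' N]
    calc ENNReal.ofReal (sigmaMax (M - N))
        ≤ ENNReal.ofReal (sigmaMax (G - N') + sigmaMax (M - G) + sigmaMax (N' - N)) :=
          ENNReal.ofReal_le_ofReal h3
      _ ≤ ENNReal.ofReal (sigmaMax (G - N')) + ENNReal.ofReal (sigmaMax (M - G))
          + ENNReal.ofReal (sigmaMax (N' - N)) :=
          ENNReal.ofReal_add_le.trans (add_le_add_left ENNReal.ofReal_add_le _)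
      _ ≤ _ := add_le_add (add_le_add (ENNReal.ofReal_le_ofReal hle) h1) h2
  · have h1 := S.ofReal_sigmaMax_D_sub_le_supNormDiff (S.extended ε ϖ)
    have h2 := (S.reduced ε ϖ r).ofReal_sigmaMax_D_sub_le_supNormDiff
      ((S.reduced ε ϖ r).extended ε ϖ)
    -- Both extended systems have direct term D_ε, so at infinity the truncation error vanishes and
    -- the two norms suffice.
    have hD : ((S.reduced ε ϖ r).extended ε ϖ).D = (S.extended ε ϖ).D := by rw [hEr]; rfl
    rw [hD, sigmaMax_sub_comm] at h2
    calc ENNReal.ofReal (sigmaMax (S.D - (S.reduced ε ϖ r).D))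
        ≤ ENNReal.ofReal (sigmaMax (S.D - (S.extended ε ϖ).D)
          + sigmaMax ((S.extended ε ϖ).D - (S.reduced ε ϖ r).D)) :=
          ENNReal.ofReal_le_ofReal (sigmaMax_sub_le _ _ _)
      _ ≤ S.supNormDiff (S.extended ε ϖ)
          + (S.reduced ε ϖ r).supNormDiff ((S.reduced ε ϖ r).extended ε ϖ) :=
          ENNReal.ofReal_add_le.trans (add_le_add h1 h2)
      _ ≤ _ := by
          rw [add_assoc]
          exact le_add_self
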